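/- Let $K$ be a compact Hausdorff space and let $C(K)$ be the Banach space of scalar-valued (real or complex) continuous functions on $K$ with the supremum norm. For $f,g\in C(K)$ write $f\prec g$ if $f\neq g$ and $f,g$ coincide on $\operatorname{supp} f=\overline{\{t\in K: f(t)\neq 0\}}$; a $\prec$-chain is a subset of $C(K)$ any two different elements of which are $\prec$-comparable. We say that $C(K)$ (or $K$) has the Bishop property if $\inf\{\|f-g\| : f,g\in F,\ f\prec g\}=0$ for every norm-bounded uncountable $\prec$-chain $F\subseteq C(K)$. For $\delta>0$, a $\delta$-$\prec$-chain is a set $F\subseteq C(K)$ such that for any two different $f,g\in F$ we have $\|f-g\|\geqslant\delta$ and either $f\prec g$ or $g\prec f$. For closed $M\subseteq K$ and $\delta>0$, let $\sim_M$ be the equivalence relation on a $\delta$-$\prec$-chain $F$ given by $f\sim_M g$ if and only if $\|(f-g)|_M\|<\delta$, where $\|\cdot\|$ is the supremum norm on $C(M)$ (equal to $0$ if $M=\varnothing$). A linear order is scattered if it contains no order-isomorphic copy of $\mathbb{Q}$. Given a closed set $N\subseteq K$ and $t\in N$, we say that $t$ has a local base of connected sets relative to $N$ if for every $U\ni t$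 open in $N$ there is a connected set $V$, open in $N$, with $t\in V\subseteq U$. **Theorem 3.3.** Let $M\subseteq K$ be closed, and suppose that $K\setminus M=\bigcup_{n=1}^\infty H_n$, where each $H_n$ is open in $\overline{H_n}$ and every point of $H_n$ has a local base of connected sets relative to $\overline{H_n}$. Then: 1. for every $\delta>0$ and every $\delta$-$\prec$-chain $F\subseteq C(K)$, every equivalence class of $\sim_M$ in $F$ is countable, and scattered with respect to the order induced by $\prec$; 2. if $C(M)$ has the Bishop property, then so does $C(K)$; 3. in particular, if $M=\varnothing$, then $C(K)$ has the Bishop property. Consequently, every locally connected compact Hausdorff space has the Bishop property, and so does every compact Hausdorff space that is $\sigma$-discrete, i.e. a countable union of subsets each of which is discrete in its relative topology. -/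

import Mathlib

noncomputable section

namespace Bish

section Order

variable {𝕜 K : Type*} [RCLike 𝕜] [TopologicalSpace K]

/-- The strict order `f ≺ g` on `C(K)`: `f ≠ g`, and `f` and `g` agree on the closed support
of `f`. -/
def Prec (f g : C(K, 𝕜)) : Prop :=
  f ≠ g ∧ Set.EqOn f g (tsupport f)

theorem Prec.eq_zero_or_eq {f g : C(K, 𝕜)} (h : Prec f g) (t : K) : f t = 0 ∨ f t = g t := by
  by_cases h0 : f t = 0
  · exact Or.inl h0
  · exact Or.inr (h.2 (subset_tsupport f h0))

theorem chain_values {F : Set C(K, 𝕜)} (hF : IsChain Prec F) {f g : C(K, 𝕜)} (hf : f ∈ F)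
    (hg : g ∈ F) (t : K) : f t = 0 ∨ g t = 0 ∨ f t = g t := by
  by_cases hne : f = g
  · simp [hne]
  · rcases hF hf hg hne with h | h <;> rcases h.eq_zero_or_eq t with h | h <;> simp [h]

variable [CompactSpace K]

/-- `f ≺_δ g`: `f ≺ g` and `‖f - g‖ ≥ δ` in the supremum norm. -/
def PrecDelta (δ : ℝ) (f g : C(K, 𝕜)) : Prop :=
  Prec f g ∧ δ ≤ ‖f - g‖

/-- A `δ`-`≺`-chain: any two different elements are comparable for `≺_δ`. -/
def IsDeltaChain (δ : ℝ) (F : Set C(K, 𝕜)) : Prop :=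
  IsChain (PrecDelta δ) F

theorem IsDeltaChain.isChain {δ : ℝ} {F : Set C(K, 𝕜)} (hF : IsDeltaChain δ F) :
    IsChain Prec F :=
  fun _ hf _ hg hne => (hF hf hg hne).imp And.left And.left

/-- The Bishop property of a bounded operator `T : C(K) → X`: for every norm-bounded uncountable
`≺`-chain `F`, the infimum of `‖T f - T g‖` over all `f ≺ g` in `F` is `0`. -/
def OperatorHasBishop {X : Type*} [NormedAddCommGroup X] [NormedSpace 𝕜 X]
    (T : C(K, 𝕜) →L[𝕜] X) : Prop :=
  ∀ F : Set C(K, 𝕜), Bornology.IsBounded F → ¬ F.Countable → IsChain Prec F →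
    IsGLB {r : ℝ | ∃ f ∈ F, ∃ g ∈ F, Prec f g ∧ r = ‖T f - T g‖} 0

variable (𝕜 K) in
/-- `C(K)` (equivalently, `K`) has the Bishop property if the identity operator of `C(K)` has. -/
def HasBishop : Prop :=
  OperatorHasBishop (ContinuousLinearMap.id 𝕜 C(K, 𝕜))

end Order

section Sim

variable {𝕜 K : Type*} [RCLike 𝕜] [TopologicalSpace K] [CompactSpace K]

instance compactSpace_closeds (M : TopologicalSpace.Closeds K) : CompactSpace (M : Set K) :=
  isCompact_iff_compactSpace.mp M.isClosed.isCompact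

/-- `f ∼_M g`: the supremum norm of `(f - g)|_M` in `C(M)` is less than `δ`. -/
def Sim (M : TopologicalSpace.Closeds K) (δ : ℝ) (f g : C(K, 𝕜)) : Prop :=
  ‖(f - g).restrict (M : Set K)‖ < δ

theorem sim_iff {M : TopologicalSpace.Closeds K} {δ : ℝ} (hδ : 0 < δ) {f g : C(K, 𝕜)} :
    Sim M δ f g ↔ ∀ t ∈ M, ‖f t - g t‖ < δ := by
  unfold Sim
  rw [ContinuousMap.norm_lt_iff _ hδ]
  exact ⟨fun h t ht => h ⟨t, ht⟩, fun h t => h t.1 t.2⟩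

/-- The equivalence relation `∼_M` on a `≺`-chain `F`. -/
def simSetoid {F : Set C(K, 𝕜)} (hF : IsChain Prec F) (M : TopologicalSpace.Closeds K)
    {δ : ℝ} (hδ : 0 < δ) : Setoid F where
  r f g := Sim M δ f.1 g.1
  iseqv :=
    { refl := fun f => (sim_iff hδ).2 fun t _ => by simpa using hδ
      symm := fun {f g} h => (sim_iff hδ).2 fun t ht => by
        rw [norm_sub_rev]; exact (sim_iff hδ).1 h t ht
      trans := fun {f g h} h₁ h₂ => (sim_iff hδ).2 fun t ht => by
        have a := (sim_iff hδ).1 h₁ t ht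
        have b := (sim_iff hδ).1 h₂ t ht
        rcases chain_values hF f.2 h.2 t with e | e | e
        · rcases chain_values hF g.2 h.2 t with e' | e' | e'
          · rwa [e, ← e']
          · simpa [e, e'] using hδ
          · rwa [← e']
        · rcases chain_values hF f.2 g.2 t with e' | e' | e'
          · simpa [e, e'] using hδ
          · rwa [e, ← e']
          · rwa [e']
        · simpa [e] using hδ }

end Sim

/-- The set `E`, with the order induced by the strict order `r`, is scattered: it contains no
order-isomorphic copy of the rationals. -/
def IsScatteredOrder {α : Type*} (r : α → α → Prop) (E : Set α) : Prop :=
  IsEmpty (((· < ·) : ℚ → ℚ → Prop) ↪r Subrel r (· ∈ E))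

section Topology

variable {K : Type*} [TopologicalSpace K]

/-- `A` is a subset of `N` that is open in the relative topology of `N`. -/
def IsOpenIn (A N : Set K) : Prop :=
  ∃ O : Set K, IsOpen O ∧ A = O ∩ N

/-- The point `t` has a local base of connected sets relative to `N`. -/
def HasConnectedLocalBase (N : Set K) (t : K) : Prop :=
  ∀ U : Set K, IsOpenIn U N → t ∈ U →
    ∃ V : Set K, IsOpenIn V N ∧ IsConnected V ∧ t ∈ V ∧ V ⊆ U

variable (K) in
/-- `K` is a countable union of relatively discrete subsets. -/
def IsSigmaDiscrete : Prop :=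
  ∃ D : ℕ → Set K, (∀ n, IsDiscrete (D n)) ∧ ⋃ n, D n = Set.univ

end Topology

end Bish

end

/-! Along a `≺`-chain the value at a fixed point jumps at most once, from zero to a fixed number.
Hence, for functions `f p` from one class of `∼_M` in a `δ`-chain, the closed sets `D p q = {t | δ ≤
‖f p t - f q t‖}` lie off `M`, are nonempty for `p < q`, and satisfy `D p r = D p q ∪ D q r` for `p
≤ q ≤ r`. On a connected, relatively open piece of `closure (H n)` where `f q` has no zero, each `f
r` with `r ≤ q` is either `f q` or `0`. So, by compactness, where `D p q` meets a closed part of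
`closure (H n)` only inside `H n`, it distinguishes finitely many classes of indices between `p` and
`q`.

This drives a Baire-type construction (`IsSepFamily.not_hasFusion`): index intervals and closed sets
`Z` shrink so that stage `n` avoids `H n`, while `Z` keeps separating points of every smaller
interval. Compactness then yields a point of `D` outside all `H n`, which is absurd. Intervals of
`ℚ` give scatteredness; tails, with duality, give countable cofinality and coinitiality of every
suborder. These force countability (`countable_of_countable_Icc_of_embedding`).

A bounded uncountable chain with all distances at least `δ` would therefore meet uncountably many
classes, and representatives restricted to `M` would violate the Bishop property of `C(M)`. -/

namespace Bish

open Set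

/-! ### Separation families over linear orders -/

section Separation

/-- `R` is the complement of an equivalence relation with convex classes. -/
structure IsConvexSep {ι : Type*} [LinearOrder ι] (R : ι → ι → Prop) : Prop where
  irrefl : ∀ p, ¬ R p p
  symm : ∀ p q, R p q → R q p
  split : ∀ p q r, p ≤ q → q ≤ r → (R p r ↔ R p q ∨ R q r)

theorem IsConvexSep.mono {ι : Type*} [LinearOrder ι] {R : ι → ι → Prop} (hR : IsConvexSep R)
    {p p' q q' : ι} (h₁ : p' ≤ p) (h₂ : p ≤ q) (h₃ : q ≤ q') (h : R p q) : R p' q' :=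
  (hR.split p' p q' h₁ (h₂.trans h₃)).2 (Or.inr ((hR.split p q q' h₂ h₃).2 (Or.inl h)))

/-- `R` separates two points of every member of `B` contained in `J`. -/
def IsLargeOn {ι : Type*} [LinearOrder ι] (B : Set (Set ι)) (R : ι → ι → Prop) (J : Set ι) :
    Prop :=
  ∀ J' ∈ B, J' ⊆ J → ∃ p ∈ J', ∃ q ∈ J', p < q ∧ R p q

/-- If `R` has finitely many classes on every interval with end points in `J ∈ B`, then some
member of `B` inside `J` lies in one class. -/
def HasThinning {ι : Type*} [LinearOrder ι] (B : Set (Set ι)) : Prop :=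
  ∀ J ∈ B, ∀ R : ι → ι → Prop, IsConvexSep R →
    (∀ p ∈ J, ∀ q ∈ J, p ≤ q → ∀ s : ℕ → ι, (∀ n, s n ∈ Icc p q) →
      ∃ m n, m < n ∧ ¬ R (s m) (s n)) →
    ∃ J' ∈ B, J' ⊆ J ∧ ∀ p ∈ J', ∀ q ∈ J', ¬ R p q

/-- Decreasing sequences of large relations are realised on a decreasing sequence of intervals. -/
def HasFusion {ι : Type*} [LinearOrder ι] (B : Set (Set ι)) : Prop :=
  ∀ (J : ℕ → Set ι) (R : ℕ → ι → ι → Prop), (∀ n, J n ∈ B) → Antitone J →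
    (∀ n, IsConvexSep (R n)) → (∀ n, IsLargeOn B (R n) (J n)) →
    ∃ p q : ℕ → ι, Monotone p ∧ Antitone q ∧
      ∀ n, p n ∈ J n ∧ q n ∈ J n ∧ p n ≤ q n ∧ R n (p n) (q n)

/-- Two distinct terms of an injective sequence in the interval are not separated; by convexity the
interval between them lies in one class. -/
theorem hasThinning_Icc_rat : HasThinning {J : Set ℚ | ∃ a b, a < b ∧ J = Icc a b} := by
  rintro _ ⟨a, b, hab, rfl⟩ R hR hfin
  let e : ℕ ↪ Icc a b := (Icc_infinite hab).natEmbedding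
  obtain ⟨m, n, hmn, h⟩ := hfin a (left_mem_Icc.2 hab.le) b (right_mem_Icc.2 hab.le) hab.le
    (fun n => (e n).1) (fun n => (e n).2)
  have key : ∀ p q : ℚ, p ∈ Icc a b → q ∈ Icc a b → p < q → ¬ R p q →
      ∃ J' ∈ {J : Set ℚ | ∃ a b, a < b ∧ J = Icc a b}, J' ⊆ Icc a b ∧
        ∀ p ∈ J', ∀ q ∈ J', ¬ R p q := by
    intro p q hp hq hpq hn
    refine ⟨Icc p q, ⟨p, q, hpq, rfl⟩, Icc_subset_Icc hp.1 hq.2, ?_⟩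
    intro u hu v hv huv
    rcases le_total u v with h | h
    · exact hn (hR.mono hu.1 h hv.2 huv)
    · exact hn (hR.mono hv.1 h hu.2 (hR.symm _ _ huv))
  have hne : (e m).1 ≠ (e n).1 := fun h' => hmn.ne (e.injective (Subtype.ext h'))
  rcases hne.lt_or_gt with hlt | hlt
  · exact key _ _ (e m).2 (e n).2 hlt h
  · exact key _ _ (e n).2 (e m).2 hlt fun h' => h (hR.symm _ _ h')

theorem hasFusion_Icc_rat : HasFusion {J : Set ℚ | ∃ a b, a < b ∧ J = Icc a b} := by
  intro J R hJ hanti hR hL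
  choose a b hab hJ using hJ
  have hsub : ∀ {m n}, m ≤ n → a m ≤ a n ∧ b n ≤ b m := by
    intro m n hmn
    have := hanti hmn
    rw [hJ m, hJ n, Icc_subset_Icc_iff (hab n).le] at this
    exact this
  refine ⟨a, b, fun m n h => (hsub h).1, fun m n h => (hsub h).2, fun n => ?_⟩
  rw [hJ n]
  refine ⟨left_mem_Icc.2 (hab n).le, right_mem_Icc.2 (hab n).le, (hab n).le, ?_⟩
  obtain ⟨p, hp, q, hq, hpq, h⟩ := hL n (J n) ⟨a n, b n, hab n, hJ n⟩ subset_rfl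
  rw [hJ n] at hp hq
  exact (hR n).mono hp.1 hpq.le hq.2 h

/-- If no tail lay in one class, iteration would give an increasing sequence of pairwise separated
points. By `hb` it sits in a bounded interval, against finiteness there. -/
theorem hasThinning_Ici {ι : Type*} [LinearOrder ι] (hb : ∀ s : ℕ → ι, ∃ q, ∀ n, s n < q) :
    HasThinning {J : Set ι | ∃ a, J = Ici a} := by
  rintro _ ⟨a, rfl⟩ R hR hfin
  by_contra hcon
  have hstep : ∀ u : Ici a, ∃ v : Ici a, u.1 < v.1 ∧ R u.1 v.1 := by
    intro u
    by_contra hu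
    push Not at hu
    refine hcon ⟨Ici u.1, ⟨u.1, rfl⟩, Ici_subset_Ici.2 u.2, ?_⟩
    have key : ∀ p q, u.1 ≤ p → p ≤ q → ¬ R p q := by
      intro p q hp hpq h
      have h' := hR.mono hp hpq le_rfl h
      rcases (hp.trans hpq).eq_or_lt with he | hlt
      · exact hR.irrefl _ (he ▸ h')
      · exact hu ⟨q, u.2.trans (hp.trans hpq)⟩ hlt h'
    intro p hp q hq h
    rcases le_total p q with h' | h'
    · exact key p q hp h' h
    · exact key q p hq h' (hR.symm _ _ h)
  choose g hg using hstep
  let s : ℕ → Ici a := fun n => g^[n] ⟨a, self_mem_Ici⟩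
  have hs : ∀ n, s (n + 1) = g (s n) := fun n => Function.iterate_succ_apply' g n _
  have hmono : StrictMono fun n => (s n).1 := strictMono_nat_of_lt_succ fun n => by
    rw [hs]; exact (hg _).1
  obtain ⟨q, hq⟩ := hb fun n => (s n).1
  obtain ⟨m, n, hmn, h⟩ := hfin a self_mem_Ici q ((s 0).2.trans (hq 0).le)
    ((s 0).2.trans (hq 0).le) (fun n => (s n).1) fun n => ⟨(s n).2, (hq n).le⟩
  refine h (hR.mono le_rfl (hmono (Nat.lt_succ_self m)).le (hmono.monotone hmn) ?_)
  simp only [Nat.succ_eq_add_one, hs]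
  exact (hg _).2

/-- Constant sequences suffice: `p` bounds all left ends, and `r` bounds points `q n` separated from
`p` by `R n`. -/
theorem hasFusion_Ici {ι : Type*} [LinearOrder ι] (hb : ∀ s : ℕ → ι, ∃ q, ∀ n, s n < q) :
    HasFusion {J : Set ι | ∃ a, J = Ici a} := by
  intro J R hJ _ hR hL
  choose a hJ using hJ
  obtain ⟨p, hp⟩ := hb a
  have h : ∀ n, ∃ q, p ≤ q ∧ R n p q := by
    intro n
    obtain ⟨u, hu, v, -, huv, h⟩ := hL n (Ici p) ⟨p, rfl⟩ (by
      rw [hJ n]; exact Ici_subset_Ici.2 (hp n).le)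
    exact ⟨v, hu.trans huv.le, (hR n).mono hu huv.le le_rfl h⟩
  choose q hpq hq using h
  obtain ⟨r, hr⟩ := hb q
  have hpr : p ≤ r := (hpq 0).trans (hr 0).le
  refine ⟨fun _ => p, fun _ => r, monotone_const, antitone_const, fun n => ?_⟩
  rw [hJ n]
  exact ⟨(hp n).le, (hp n).le.trans hpr, hpr, (hR n).mono le_rfl (hpq n) (hr n).le (hq n)⟩

/-- A family of closed sets `D p q`, thought of as the points where `p` and `q` are separated,
which is locally two-valued along each `H n`. -/
structure IsSepFamily {ι K : Type*} [LinearOrder ι] [TopologicalSpace K] (H : ℕ → Set K)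
    (D : ι → ι → Set K) : Prop where
  isClosed : ∀ p q, IsClosed (D p q)
  nonempty : ∀ p q, p < q → (D p q).Nonempty
  subset : ∀ p q, D p q ⊆ ⋃ n, H n
  self : ∀ p, D p p = ∅
  symm : ∀ p q, D p q = D q p
  split : ∀ p q r, p ≤ q → q ≤ r → D p r = D p q ∪ D q r
  loc : ∀ n p q, p ≤ q → ∀ x ∈ H n ∩ D p q, ∃ W, IsOpen W ∧ x ∈ W ∧ ∀ r ∈ Icc p q,
    D p r ∩ W ∩ closure (H n) = ∅ ∨ D r q ∩ W ∩ closure (H n) = ∅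

variable {ι K : Type*} [LinearOrder ι] [TopologicalSpace K] {H : ℕ → Set K} {D : ι → ι → Set K}

theorem IsSepFamily.dual (hD : IsSepFamily H D) :
    IsSepFamily H fun p q : ιᵒᵈ => D (OrderDual.ofDual p) (OrderDual.ofDual q) where
  isClosed _ _ := hD.isClosed _ _
  nonempty p q h := by
    rw [hD.symm]
    exact hD.nonempty _ _ h
  subset _ _ := hD.subset _ _
  self _ := hD.self _
  symm _ _ := hD.symm _ _
  split p q r h₁ h₂ := by
    rw [hD.symm (OrderDual.ofDual p) (OrderDual.ofDual r),
      hD.split (OrderDual.ofDual r) (OrderDual.ofDual q) (OrderDual.ofDual p) h₂ h₁, union_comm, hD.symm (OrderDual.ofDual q)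
      (OrderDual.ofDual p), hD.symm (OrderDual.ofDual r) (OrderDual.ofDual q)]
  loc n p q hpq x hx := by
    obtain ⟨W, hW, hxW, h⟩ := hD.loc n (OrderDual.ofDual q) (OrderDual.ofDual p) hpq x
      (by rw [hD.symm]; exact hx)
    refine ⟨W, hW, hxW, fun r hr => ?_⟩
    have := h (OrderDual.ofDual r) ⟨hr.2, hr.1⟩
    rw [hD.symm _ (OrderDual.ofDual r), hD.symm (OrderDual.ofDual r) (OrderDual.ofDual p)] at this
    exact this.symm

theorem IsSepFamily.isConvexSep (hD : IsSepFamily H D) (Z : Set K) :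
    IsConvexSep fun p q => (D p q ∩ Z).Nonempty where
  irrefl p := by simp [hD.self]
  symm p q h := by rwa [hD.symm]
  split p q r h₁ h₂ := by rw [hD.split p q r h₁ h₂, union_inter_distrib_right, union_nonempty]

/-- Finitely many two-valued neighbourhoods cover the compact set, and each index has a pattern: the
neighbourhoods that `D p (s i)` misses within `closure (H n)`. Two indices share a pattern, and a
point separating them would contradict two-valuedness. -/
theorem IsSepFamily.exists_not_sep [CompactSpace K] (hD : IsSepFamily H D) {n : ℕ} {Z : Set K}
    (hZ : IsClosed Z) {p q : ι} (hpq : p ≤ q)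
    (hsub : D p q ∩ (Z ∩ closure (H n)) ⊆ H n) (s : ℕ → ι) (hs : ∀ i, s i ∈ Icc p q) :
    ∃ i j, i < j ∧ ¬ (D (s i) (s j) ∩ (Z ∩ closure (H n))).Nonempty := by
  classical
  have hC : IsCompact (D p q ∩ (Z ∩ closure (H n))) :=
    ((hD.isClosed p q).inter (hZ.inter isClosed_closure)).isCompact
  have hloc : ∀ x : ↥(D p q ∩ (Z ∩ closure (H n))), ∃ W, IsOpen W ∧ x.1 ∈ W ∧ ∀ r ∈ Icc p q,
      D p r ∩ W ∩ closure (H n) = ∅ ∨ D r q ∩ W ∩ closure (H n) = ∅ :=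
    fun x => hD.loc n p q hpq x.1 ⟨hsub x.2, x.2.1⟩
  choose W hWo hxW hW using hloc
  obtain ⟨t, ht⟩ := hC.elim_finite_subcover W hWo fun x hx => mem_iUnion.2 ⟨⟨x, hx⟩, hxW _⟩
  let pat : ℕ → t → Prop := fun i x => D p (s i) ∩ W x.1 ∩ closure (H n) = ∅
  obtain ⟨i, j, hij, he⟩ := Finite.exists_ne_map_eq_of_infinite pat
  have key : ∀ u v, u ∈ Icc p q → v ∈ Icc p q → u ≤ v →
      (∀ x : t, D p u ∩ W x.1 ∩ closure (H n) = ∅ ↔ D p v ∩ W x.1 ∩ closure (H n) = ∅) →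
      ¬ (D u v ∩ (Z ∩ closure (H n))).Nonempty := by
    rintro u v hu hv huv hpat ⟨y, hy, hyZ, hyN⟩
    have hpv : y ∈ D p v := by rw [hD.split p u v hu.1 huv]; exact Or.inr hy
    have huq : y ∈ D u q := by rw [hD.split u v q huv hv.2]; exact Or.inl hy
    have hpq' : y ∈ D p q := by rw [hD.split p u q hu.1 hu.2]; exact Or.inr huq
    obtain ⟨x, hxt, hyW⟩ := mem_iUnion₂.1 (ht ⟨hpq', hyZ, hyN⟩)
    have hne : ¬ D p v ∩ W x ∩ closure (H n) = ∅ := fun h =>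
      (h ▸ (⟨⟨hpv, hyW⟩, hyN⟩ : y ∈ D p v ∩ W x ∩ closure (H n)) : y ∈ (∅ : Set K))
    rcases hW x u hu with h | h
    · exact hne ((hpat ⟨x, hxt⟩).1 h)
    · exact (h ▸ (⟨⟨huq, hyW⟩, hyN⟩ : y ∈ D u q ∩ W x ∩ closure (H n)) : y ∈ (∅ : Set K))
  have hp : ∀ x, pat i x ↔ pat j x := fun x => by rw [he]
  have hall : ¬ (D (s i) (s j) ∩ (Z ∩ closure (H n))).Nonempty := by
    rcases le_total (s i) (s j) with h | h
    · exact key _ _ (hs i) (hs j) h hp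
    · rw [hD.symm]
      exact key _ _ (hs j) (hs i) h fun x => (hp x).symm
  rcases hij.lt_or_gt with h | h
  · exact ⟨i, j, h, hall⟩
  · exact ⟨j, i, h, by rwa [hD.symm]⟩

theorem IsSepFamily.exists_step [CompactSpace K] (hD : IsSepFamily H D)
    (hH : ∀ n, IsOpenIn (H n) (closure (H n))) {B : Set (Set ι)} (hB : HasThinning B) (n : ℕ)
    {J : Set ι} {Z : Set K} (hJ : J ∈ B) (hZ : IsClosed Z)
    (hL : IsLargeOn B (fun p q => (D p q ∩ Z).Nonempty) J) :
    ∃ J' ∈ B, ∃ Z', J' ⊆ J ∧ Z' ⊆ Z ∧ IsClosed Z' ∧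
      IsLargeOn B (fun p q => (D p q ∩ Z').Nonempty) J' ∧
      ∀ p ∈ J', ∀ q ∈ J', D p q ∩ Z' ∩ H n = ∅ := by
  obtain ⟨O, hO, hHO⟩ := hH n
  -- Either the relative boundary `closure (H n) \ O` of `H n` still carries a large part of `Z`,
  -- and `Z` shrinks to it; or on some interval it separates nothing, so that `D p q` meets `Z ∩
  -- closure (H n)` only inside `H n` and thinning applies.
  by_cases hA : ∃ J' ∈ B, J' ⊆ J ∧
      IsLargeOn B (fun p q => (D p q ∩ (Z ∩ (closure (H n) ∩ Oᶜ))).Nonempty) J'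
  · obtain ⟨J', hJ', hsub, hL'⟩ := hA
    refine ⟨J', hJ', _, hsub, inter_subset_left,
      hZ.inter (isClosed_closure.inter hO.isClosed_compl), hL', fun p _ q _ => ?_⟩
    refine eq_empty_of_forall_notMem fun x hx => ?_
    have hxO : x ∈ O := (hHO ▸ hx.2 : x ∈ O ∩ closure (H n)).1
    exact hx.1.2.2.2 hxO
  · have hnot : ¬ IsLargeOn B (fun p q => (D p q ∩ (Z ∩ (closure (H n) ∩ Oᶜ))).Nonempty) J :=
      fun h => hA ⟨J, hJ, subset_rfl, h⟩
    unfold IsLargeOn at hnot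
    push Not at hnot
    obtain ⟨J₁, hJ₁, hsub₁, h₁⟩ := hnot
    have hfin : ∀ p ∈ J₁, ∀ q ∈ J₁, p ≤ q → D p q ∩ (Z ∩ closure (H n)) ⊆ H n := by
      intro p hp q hq hpq x hx
      rcases hpq.eq_or_lt with rfl | hlt
      · rw [hD.self] at hx
        exact absurd hx.1 (notMem_empty x)
      · rw [hHO]
        refine ⟨by_contra fun hxO => ?_, hx.2.2⟩
        have := h₁ p hp q hq hlt
        exact (this ▸ (⟨hx.1, hx.2.1, hx.2.2, hxO⟩ :
          x ∈ D p q ∩ (Z ∩ (closure (H n) ∩ Oᶜ))) : x ∈ (∅ : Set K))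
    obtain ⟨J₂, hJ₂, hsub₂, h₂⟩ := hB J₁ hJ₁ _ (hD.isConvexSep (Z ∩ closure (H n)))
      fun p hp q hq hpq s hs => hD.exists_not_sep hZ hpq (hfin p hp q hq hpq) s hs
    refine ⟨J₂, hJ₂, Z, hsub₂.trans hsub₁, subset_rfl, hZ,
      fun J' hJ' hs => hL J' hJ' (hs.trans (hsub₂.trans hsub₁)), fun p hp q hq => ?_⟩
    exact eq_empty_of_forall_notMem fun x hx =>
      h₂ p hp q hq ⟨x, hx.1.1, hx.1.2, subset_closure hx.2⟩

theorem IsSepFamily.not_hasFusion [CompactSpace K] (hD : IsSepFamily H D)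
    (hH : ∀ n, IsOpenIn (H n) (closure (H n))) {B : Set (Set ι)} (hne : B.Nonempty)
    (hB₀ : ∀ J ∈ B, ∃ p ∈ J, ∃ q ∈ J, p < q) (hB : HasThinning B) : ¬ HasFusion B := by
  intro hF
  let S := {P : Set ι × Set K // P.1 ∈ B ∧ IsClosed P.2 ∧
    IsLargeOn B (fun p q => (D p q ∩ P.2).Nonempty) P.1}
  have hstep : ∀ (n : ℕ) (P : S), ∃ P' : S, P'.1.1 ⊆ P.1.1 ∧ P'.1.2 ⊆ P.1.2 ∧
      ∀ p ∈ P'.1.1, ∀ q ∈ P'.1.1, D p q ∩ P'.1.2 ∩ H n = ∅ := by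
    rintro n ⟨⟨J, Z⟩, hJ, hZ, hL⟩
    obtain ⟨J', hJ', Z', h₁, h₂, h₃, h₄, h₅⟩ := hD.exists_step hH hB n hJ hZ hL
    exact ⟨⟨⟨J', Z'⟩, hJ', h₃, h₄⟩, h₁, h₂, h₅⟩
  choose g hgJ hgZ hg using hstep
  obtain ⟨J₀, hJ₀⟩ := hne
  let P₀ : S := ⟨⟨J₀, univ⟩, hJ₀, isClosed_univ, fun J' hJ' _ => by
    obtain ⟨p, hp, q, hq, hpq⟩ := hB₀ J' hJ'
    exact ⟨p, hp, q, hq, hpq, by simpa using hD.nonempty p q hpq⟩⟩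
  let P : ℕ → S := fun n => Nat.rec P₀ g n
  have hJanti : Antitone fun n => (P n).1.1 := antitone_nat_of_succ_le fun n => hgJ n (P n)
  have hZanti : Antitone fun n => (P n).1.2 := antitone_nat_of_succ_le fun n => hgZ n (P n)
  obtain ⟨p, q, hp, hq, hpq⟩ := hF (fun n => (P n).1.1)
    (fun n u v => (D u v ∩ (P n).1.2).Nonempty) (fun n => (P n).2.1) hJanti
    (fun n => hD.isConvexSep _) (fun n => (P n).2.2.2)
  have hcl : ∀ n, IsClosed (D (p n) (q n) ∩ (P n).1.2) := fun n =>
    (hD.isClosed _ _).inter (P n).2.2.1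
  obtain ⟨x, hx⟩ := IsCompact.nonempty_iInter_of_sequence_nonempty_isCompact_isClosed
    (fun n => D (p n) (q n) ∩ (P n).1.2)
    -- `D (p (n + 1)) (q (n + 1))` is the middle piece of `D (p n) (q n)` split at the two inner
    -- indices.
    (fun n => by
      refine inter_subset_inter ?_ (hZanti n.le_succ)
      have h₁ := hp n.le_succ
      have h₂ := hq n.le_succ
      have h₃ := (hpq (n + 1)).2.2.1
      rw [hD.split (p n) (p (n + 1)) (q n) h₁ (h₃.trans h₂),
        hD.split (p (n + 1)) (q (n + 1)) (q n) h₃ h₂]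
      exact subset_union_left.trans subset_union_right)
    (fun n => (hpq n).2.2.2) (hcl 0).isCompact hcl
  rw [mem_iInter] at hx
  obtain ⟨n, hn⟩ := mem_iUnion.1 (hD.subset _ _ (hx 0).1)
  -- `H n` is avoided from stage `n + 1` on, since `P (n + 1)` is `g n (P n)`.
  have h := hg n (P n) _ (hpq (n + 1)).1 _ (hpq (n + 1)).2.1
  exact (h ▸ (⟨hx (n + 1), hn⟩ : x ∈ D (p (n + 1)) (q (n + 1)) ∩ (P (n + 1)).1.2 ∩ H n) :
    x ∈ (∅ : Set K))

theorem not_isSepFamily_rat [CompactSpace K] (hH : ∀ n, IsOpenIn (H n) (closure (H n)))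
    {D : ℚ → ℚ → Set K} : ¬ IsSepFamily H D := fun hD =>
  hD.not_hasFusion hH (B := {J | ∃ a b, a < b ∧ J = Icc a b})
    ⟨_, 0, 1, one_pos, rfl⟩
    (by rintro _ ⟨a, b, h, rfl⟩; exact ⟨a, left_mem_Icc.2 h.le, b, right_mem_Icc.2 h.le, h⟩)
    hasThinning_Icc_rat hasFusion_Icc_rat

theorem IsSepFamily.exists_seq_unbounded [CompactSpace K] (hD : IsSepFamily H D)
    (hH : ∀ n, IsOpenIn (H n) (closure (H n))) [Nonempty ι] :
    ∃ s : ℕ → ι, ∀ q, ∃ n, q ≤ s n := by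
  by_contra hb
  push Not at hb
  refine hD.not_hasFusion hH (B := {J | ∃ a, J = Ici a})
    ⟨_, Classical.arbitrary ι, rfl⟩ ?_ (hasThinning_Ici hb)
    (hasFusion_Ici hb)
  rintro _ ⟨a, rfl⟩
  obtain ⟨q, hq⟩ := hb fun _ => a
  exact ⟨a, self_mem_Ici, q, (hq 0).le, hq 0⟩

end Separation

/-! ### Countability of linear orders without a copy of the rationals -/

section LinearOrder

variable {α : Type*} [LinearOrder α]

/-- Condensation: identify points with countably many points between them. Classes are countable by
`hup` and `hdown`; if there were uncountably many, their representatives would form a nontrivial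
dense order, which contains `ℚ`. -/
theorem countable_of_countable_Icc_of_embedding
    (hQ : IsEmpty (ℚ ↪o α))
    (hup : ∀ p : α, {q | p ≤ q ∧ (Icc p q).Countable}.Countable)
    (hdown : ∀ p : α, {q | q ≤ p ∧ (Icc q p).Countable}.Countable) : Countable α := by
  by_contra hα
  let s : Setoid α :=
    { r := fun p q => (uIcc p q).Countable
      iseqv :=
        { refl := fun p => by simp
          symm := fun {p q} h => by rwa [uIcc_comm]
          trans := fun {p q r} h₁ h₂ => (h₁.union h₂).mono uIcc_subset_uIcc_union_uIcc } }
  have hclass : ∀ p : α, {q | (uIcc p q).Countable}.Countable := fun p =>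
    ((hup p).union (hdown p)).mono fun q hq => by
      rcases le_total p q with h | h
      · exact Or.inl ⟨h, by rwa [mem_ofPred_eq, uIcc_of_le h] at hq⟩
      · exact Or.inr ⟨h, by rwa [mem_ofPred_eq, uIcc_of_ge h] at hq⟩
  let B : Set α := range (Quotient.out : Quotient s → α)
  have hsep : ∀ p ∈ B, ∀ q ∈ B, p < q → ¬ (Icc p q).Countable := by
    rintro _ ⟨a, rfl⟩ _ ⟨b, rfl⟩ hlt hc
    refine hlt.ne (congrArg _ (Quotient.out_equiv_out.1 ?_))
    change (uIcc _ _).Countable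
    rwa [uIcc_of_le hlt.le]
  have hrep : ∀ r : α, ∃ b ∈ B, (uIcc b r).Countable := fun r =>
    ⟨_, ⟨⟦r⟧, rfl⟩, Quotient.exact (Quotient.out_eq (⟦r⟧ : Quotient s))⟩
  have hBunc : ¬ B.Countable := by
    intro hB
    refine hα (countable_univ_iff.1 ((hB.biUnion fun b _ => hclass b).mono fun r _ => ?_))
    obtain ⟨b, hb, h⟩ := hrep r
    exact mem_iUnion₂.2 ⟨b, hb, h⟩
  have : Nontrivial B := by
    rw [nontrivial_coe_sort, ← not_subsingleton_iff]
    exact fun h => hBunc h.countable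
  have : DenselyOrdered B := by
    refine ⟨fun p q hpq => ?_⟩
    have hunc := hsep p p.2 q q.2 hpq
    -- Some `r` between `p` and `q` is uncountably far from both; the representative of its class
    -- must then lie strictly between them.
    have hdiff : ¬ (Icc p.1 q.1 \ ({r | p.1 ≤ r ∧ (Icc p.1 r).Countable} ∪
        {r | r ≤ q.1 ∧ (Icc r q.1).Countable})).Countable := fun h =>
      hunc ((h.union ((hup p).union (hdown q))).mono fun r hr => by
        by_cases h' : r ∈ {r | p.1 ≤ r ∧ (Icc p.1 r).Countable} ∪
          {r | r ≤ q.1 ∧ (Icc r q.1).Countable}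
        · exact Or.inr h'
        · exact Or.inl ⟨hr, h'⟩)
    obtain ⟨r, ⟨hpr, hrq⟩, hr⟩ := Set.Infinite.nonempty fun h => hdiff (Set.Finite.countable h)
    obtain ⟨b, hb, hbr⟩ := hrep r
    refine ⟨⟨b, hb⟩, lt_of_not_ge fun h => hr (Or.inl ⟨hpr, hbr.mono ?_⟩),
      lt_of_not_ge fun h => hr (Or.inr ⟨hrq, hbr.mono ?_⟩)⟩
    · exact (Icc_subset_Icc_left (show b ≤ p.1 from h)).trans Icc_subset_uIcc
    · exact (Icc_subset_Icc_right (show q.1 ≤ b from h)).trans Icc_subset_uIcc'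
  obtain ⟨e⟩ := Order.embedding_from_countable_to_dense ℚ B
  exact hQ.elim (e.trans (OrderEmbedding.subtype (· ∈ B)))

end LinearOrder

end Bish

namespace Bish

open Set

/-! ### Chains in `C(K)` and the Bishop property -/

section Chains

variable {𝕜 K : Type*} [RCLike 𝕜] [TopologicalSpace K]

theorem Prec.eq_of_ne_zero {f g : C(K, 𝕜)} (h : Prec f g) {t : K} (ht : f t ≠ 0) : f t = g t :=
  (h.eq_zero_or_eq t).resolve_left ht

theorem Prec.trans {f g h : C(K, 𝕜)} (h₁ : Prec f g) (h₂ : Prec g h) : Prec f h := by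
  have hfg : Function.support f ⊆ Function.support g := fun t ht => by
    rw [Function.mem_support, ← h₁.eq_of_ne_zero ht]; exact ht
  refine ⟨?_, fun t ht => (h₁.2 ht).trans (h₂.2 (closure_mono hfg ht))⟩
  rintro rfl
  refine h₁.1 (ContinuousMap.ext fun t => ?_)
  rcases h₁.eq_zero_or_eq t with h | h
  · rcases h₂.eq_zero_or_eq t with h' | h'
    · rw [h, h']
    · exact h'.symm
  · exact h

/-- A connected subset of the cozero set of `h` lies inside or outside the cozero set of any
`g ≺ h`. -/
theorem Prec.support_dichotomy {g h : C(K, 𝕜)} (hgh : Prec g h) {V : Set K}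
    (hV : IsPreconnected V) (hVh : ∀ t ∈ V, h t ≠ 0) :
    (∀ t ∈ V, g t = h t) ∨ ∀ t ∈ V, g t = 0 := by
  have hu : IsOpen {t | g t ≠ 0} := isOpen_ne_fun g.continuous continuous_const
  have hv : IsOpen (tsupport g)ᶜ := (isClosed_tsupport g).isOpen_compl
  have hcov : V ⊆ {t | g t ≠ 0} ∪ (tsupport g)ᶜ := fun t ht => by
    by_cases htg : t ∈ tsupport g
    · left
      rw [mem_ofPred_eq, hgh.2 htg]
      exact hVh t ht
    · exact Or.inr htg
  rcases isPreconnected_iff_subset_of_disjoint.1 hV _ _ hu hv hcov (by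
      refine eq_empty_of_forall_notMem fun t ht => ht.2.2 (subset_tsupport g ht.2.1)) with hs | hs
  · exact Or.inl fun t ht => hgh.eq_of_ne_zero (hs ht)
  · exact Or.inr fun t ht => image_eq_zero_of_notMem_tsupport (hs ht)

theorem Prec.restrict {f g : C(K, 𝕜)} (h : Prec f g) {M : Set K}
    (hne : f.restrict M ≠ g.restrict M) : Prec (f.restrict M) (g.restrict M) := by
  refine ⟨hne, fun t ht => h.2 (?_ : t.1 ∈ tsupport f)⟩
  have hsub : tsupport (f.restrict M) ⊆ Subtype.val ⁻¹' tsupport f :=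
    closure_minimal (fun x hx => subset_tsupport f hx)
      ((isClosed_tsupport f).preimage continuous_subtype_val)
  exact hsub ht

variable [CompactSpace K]

theorem exists_le_norm_of_le_norm_sub {δ : ℝ} (hδ : 0 < δ) {f g : C(K, 𝕜)} (h : δ ≤ ‖f - g‖) :
    ∃ t, δ ≤ ‖f t - g t‖ := by
  by_contra! hlt
  exact h.not_gt ((ContinuousMap.norm_lt_iff _ hδ).2 hlt)

/-- The sets `{t | δ ≤ ‖f p t - f q t‖}` attached to a `δ`-`≺`-chain form a separation family. -/
theorem isSepFamily_of_prec {ι : Type*} [LinearOrder ι] {M : Set K} {H : ℕ → Set K}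
    (hM : Mᶜ = ⋃ n, H n)
    (hloc : ∀ n, ∀ t ∈ H n, HasConnectedLocalBase (closure (H n)) t) {δ : ℝ} (hδ : 0 < δ)
    (f : ι → C(K, 𝕜)) (hf : ∀ p q, p < q → PrecDelta δ (f p) (f q))
    (hfM : ∀ p q, ∀ t ∈ M, ‖f p t - f q t‖ < δ) :
    IsSepFamily H fun p q => {t | δ ≤ ‖f p t - f q t‖} := by
  have hval : ∀ p q, p ≤ q → ∀ t, f p t = 0 ∨ f p t = f q t := by
    intro p q hpq t
    rcases hpq.eq_or_lt with rfl | h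
    · exact Or.inr rfl
    · exact (hf p q h).1.eq_zero_or_eq t
  refine ⟨fun p q => ?_, fun p q h => ?_, fun p q t ht => ?_, fun p => ?_, fun p q => ?_,
    fun p q r hpq hqr => ?_, ?_⟩
  · exact isClosed_le continuous_const (by fun_prop)
  · exact exists_le_norm_of_le_norm_sub hδ (hf p q h).2
  · rw [← hM]
    exact fun htM => (hfM p q t htM).not_ge ht
  · exact eq_empty_of_forall_notMem fun t ht => hδ.not_ge (by simpa using ht)
  · simp only [norm_sub_rev]
  · ext t
    simp only [mem_ofPred_eq, mem_union]
    rcases hval p q hpq t with h₁ | h₁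
    · rcases hval q r hqr t with h₂ | h₂
      · simp [h₁, h₂, hδ]
      · simp [h₁, h₂, hδ]
    · rcases hval q r hqr t with h₂ | h₂
      · simp [h₁, h₂, hδ]
      · simp [h₁, h₂]
  · rintro n p q hpq t ⟨htH, ht⟩
    have hqt : f q t ≠ 0 := by
      intro h0
      rcases hval p q hpq t with h | h <;>
        simp only [mem_ofPred_eq, h, h0, sub_self, norm_zero] at ht <;> exact hδ.not_ge ht
    have hpt : f p t = 0 := by
      refine (hval p q hpq t).resolve_right fun h => ?_
      simp only [mem_ofPred_eq, h, sub_self, norm_zero] at ht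
      exact hδ.not_ge ht
    -- The jump at `t` lies between `p` and `q`, so `f p t = 0 ≠ f q t`. On a connected
    -- neighbourhood where `f q ≠ 0`, the support dichotomy applies to every `r ≤ q`.
    obtain ⟨V, ⟨O, hO, rfl⟩, hVc, htV, hVU⟩ := hloc n t htH ({t | f q t ≠ 0} ∩ closure (H n))
      ⟨_, isOpen_ne_fun (f q).continuous continuous_const, rfl⟩ ⟨hqt, subset_closure htH⟩
    have hdich : ∀ r ≤ q, (∀ y ∈ O ∩ closure (H n), f r y = f q y) ∨
        ∀ y ∈ O ∩ closure (H n), f r y = 0 := by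
      intro r hr
      rcases hr.eq_or_lt with rfl | hlt
      · exact Or.inl fun _ _ => rfl
      · exact (hf r q hlt).1.support_dichotomy hVc.isPreconnected fun y hy => (hVU hy).1
    have hp0 : ∀ y ∈ O ∩ closure (H n), f p y = 0 :=
      (hdich p hpq).resolve_left fun h => hqt ((h t htV).symm.trans hpt)
    refine ⟨O, hO, htV.1, fun r hr => ?_⟩
    rcases hdich r hr.2 with h | h
    · refine Or.inr (eq_empty_of_forall_notMem fun y hy => hδ.not_ge ?_)
      simpa [h y ⟨hy.1.2, hy.2⟩] using hy.1.1
    · refine Or.inl (eq_empty_of_forall_notMem fun y hy => hδ.not_ge ?_)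
      simpa [h y ⟨hy.1.2, hy.2⟩, hp0 y ⟨hy.1.2, hy.2⟩] using hy.1.1

theorem isEmpty_orderEmbedding_rat_of_prec {ι : Type*} [LinearOrder ι] {M : Set K}
    {H : ℕ → Set K} (hM : Mᶜ = ⋃ n, H n) (hH : ∀ n, IsOpenIn (H n) (closure (H n)))
    (hloc : ∀ n, ∀ t ∈ H n, HasConnectedLocalBase (closure (H n)) t) {δ : ℝ} (hδ : 0 < δ)
    (f : ι → C(K, 𝕜)) (hf : ∀ p q, p < q → PrecDelta δ (f p) (f q))
    (hfM : ∀ p q, ∀ t ∈ M, ‖f p t - f q t‖ < δ) : IsEmpty (ℚ ↪o ι) :=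
  ⟨fun e => not_isSepFamily_rat hH (isSepFamily_of_prec hM hloc hδ (fun q => f (e q))
    (fun _ _ h => hf _ _ (e.strictMono h)) fun _ _ => hfM _ _)⟩

/-- The points above `p` at countable distance form a suborder with a cofinal sequence, hence a
countable union of countable intervals; dually below `p`. Condensation then applies. -/
theorem countable_of_prec {ι : Type*} [LinearOrder ι] {M : Set K}
    {H : ℕ → Set K} (hM : Mᶜ = ⋃ n, H n) (hH : ∀ n, IsOpenIn (H n) (closure (H n)))
    (hloc : ∀ n, ∀ t ∈ H n, HasConnectedLocalBase (closure (H n)) t) {δ : ℝ} (hδ : 0 < δ)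
    (f : ι → C(K, 𝕜)) (hf : ∀ p q, p < q → PrecDelta δ (f p) (f q))
    (hfM : ∀ p q, ∀ t ∈ M, ‖f p t - f q t‖ < δ) : Countable ι := by
  have hsub : ∀ X : Set ι, IsSepFamily H fun p q : X => {t | δ ≤ ‖f p t - f q t‖} := fun X =>
    isSepFamily_of_prec hM hloc hδ (fun p : X => f p) (fun _ _ h => hf _ _ h)
      fun _ _ => hfM _ _
  refine countable_of_countable_Icc_of_embedding
    (isEmpty_orderEmbedding_rat_of_prec hM hH hloc hδ f hf hfM) (fun p => ?_) fun p => ?_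
  · have : Nonempty {q | p ≤ q ∧ (Icc p q).Countable} := ⟨⟨p, le_rfl, by simp⟩⟩
    obtain ⟨s, hs⟩ := (hsub {q | p ≤ q ∧ (Icc p q).Countable}).exists_seq_unbounded hH
    refine (countable_iUnion fun n => (s n).2.2).mono fun q hq => ?_
    obtain ⟨n, hn⟩ := hs ⟨q, hq⟩
    exact mem_iUnion.2 ⟨n, hq.1, hn⟩
  · have : Nonempty {q | q ≤ p ∧ (Icc q p).Countable}ᵒᵈ := ⟨OrderDual.toDual ⟨p, le_rfl, by simp⟩⟩
    obtain ⟨s, hs⟩ := (hsub {q | q ≤ p ∧ (Icc q p).Countable}).dual.exists_seq_unbounded hH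
    refine (countable_iUnion fun n => (OrderDual.ofDual (s n)).2.2).mono fun q hq => ?_
    obtain ⟨n, hn⟩ := hs (OrderDual.toDual ⟨q, hq⟩)
    exact mem_iUnion.2 ⟨n, hn, hq.1⟩

theorem countable_and_isScatteredOrder_of_mem_classes {M : TopologicalSpace.Closeds K}
    {H : ℕ → Set K} (hM : (M : Set K)ᶜ = ⋃ n, H n)
    (hH : ∀ n, IsOpenIn (H n) (closure (H n)))
    (hloc : ∀ n, ∀ t ∈ H n, HasConnectedLocalBase (closure (H n)) t) {δ : ℝ} (hδ : 0 < δ)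
    {F : Set C(K, 𝕜)} (hF : IsDeltaChain δ F) {E : Set F}
    (hE : E ∈ (simSetoid hF.isChain M hδ).classes) :
    E.Countable ∧ IsScatteredOrder (fun f g : F => Prec f.1 g.1) E := by
  classical
  obtain ⟨f₀, rfl⟩ := hE
  set E : Set F := {x | (simSetoid hF.isChain M hδ) x f₀}
  have hEM : ∀ p q : E, ∀ t ∈ (M : Set K), ‖p.1.1 t - q.1.1 t‖ < δ := fun p q =>
    (sim_iff hδ).1 ((simSetoid hF.isChain M hδ).trans p.2 ((simSetoid hF.isChain M hδ).symm q.2))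
  have hprec : ∀ p q : F, Prec p.1 q.1 → PrecDelta δ p.1 q.1 := fun p q h => by
    rcases hF p.2 q.2 h.1 with h' | h'
    · exact h'
    · exact ⟨h, by rw [norm_sub_rev]; exact h'.2⟩
  have : IsStrictTotalOrder E fun p q => Prec p.1.1 q.1.1 :=
    { irrefl := fun p h => h.1 rfl
      trans := fun p q r => Prec.trans
      trichotomous := fun p q h₁ h₂ => by
        by_contra hne
        exact (hF.isChain p.1.2 q.1.2 fun h => hne (Subtype.ext (Subtype.ext h))).elim h₁ h₂ }
  let _ : LinearOrder E := linearOrderOfSTO fun p q : E => Prec p.1.1 q.1.1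
  refine ⟨countable_of_prec hM hH hloc hδ (fun p : E => p.1.1)
    (fun p q h => hprec p.1 q.1 h) hEM, ⟨fun e => ?_⟩⟩
  exact (isEmpty_orderEmbedding_rat_of_prec hM hH hloc hδ (fun q : ℚ => (e q).1.1)
    (fun p q h => hprec _ _ (e.map_rel_iff.2 h)) fun p q => hEM (e p) (e q)).elim
    (RelEmbedding.refl _)

/-- If all distances in the chain were at least some `δ > 0`, representatives of different classes
would stay `δ` apart on `M`, and countable classes would make the restricted chain uncountable. -/
theorem hasBishop_of_countable_classes {M : TopologicalSpace.Closeds K}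
    (hcount : ∀ (δ : ℝ) (hδ : 0 < δ) (F : Set C(K, 𝕜)) (hF : IsDeltaChain δ F),
      ∀ E ∈ (simSetoid hF.isChain M hδ).classes, E.Countable)
    (hMB : HasBishop 𝕜 (M : Set K)) : HasBishop 𝕜 K := by
  intro F hFb hFu hFc
  refine ⟨?_, fun δ hδ => ?_⟩
  · rintro _ ⟨f, -, g, -, -, rfl⟩
    exact norm_nonneg _
  by_contra! hpos
  have hle : ∀ f ∈ F, ∀ g ∈ F, Prec f g → δ ≤ ‖f - g‖ := fun f hf g hg h =>
    hδ ⟨f, hf, g, hg, h, rfl⟩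
  have hF : IsDeltaChain δ F := fun f hf g hg hne =>
    (hFc hf hg hne).imp (fun h => ⟨h, hle f hf g hg h⟩) fun h => ⟨h, hle g hg f hf h⟩
  let S := simSetoid hF.isChain M hpos
  obtain ⟨o, ho⟩ : ∃ o : Quotient S → F, ∀ a, ⟦o a⟧ = a := ⟨Quotient.out, Quotient.out_eq⟩
  let c : Quotient S → C((M : Set K), 𝕜) := fun a => (o a).1.restrict (M : Set K)
  have hc : ∀ a b, a ≠ b → δ ≤ ‖c a - c b‖ := fun a b hab => by
    by_contra! hlt
    have h : (⟦o a⟧ : Quotient S) = ⟦o b⟧ :=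
      Quotient.sound (show Sim M δ (o a).1 (o b).1 from hlt)
    exact hab (by rwa [ho, ho] at h)
  have hcinj : Function.Injective c := fun a b hab => by
    by_contra hne
    have := hc a b hne
    rw [hab, sub_self, norm_zero] at this
    exact hpos.not_ge this
  have hunc : ¬ (range c).Countable := by
    intro h
    have hQ : Countable (Quotient S) := by
      have := h.to_subtype
      exact (rangeFactorization_injective.2 hcinj).countable
    have hall : (⋃ a : Quotient S, {x : F | S x (o a)}).Countable :=
      countable_iUnion fun a => hcount δ hpos F hF _ ⟨o a, rfl⟩
    refine hFu (countable_coe_iff.1 (countable_univ_iff.1 (hall.mono fun x _ => ?_)))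
    exact mem_iUnion.2 ⟨⟦x⟧, Quotient.exact (ho _).symm⟩
  have hbd : Bornology.IsBounded (range c) := by
    obtain ⟨C, hC⟩ := isBounded_iff_forall_norm_le.1 hFb
    refine isBounded_iff_forall_norm_le.2 ⟨C, ?_⟩
    rintro _ ⟨a, rfl⟩
    refine (ContinuousMap.norm_le _ ((norm_nonneg _).trans (hC _ (o a).2))).2 fun t => ?_
    exact ((o a).1.norm_coe_le_norm t.1).trans (hC _ (o a).2)
  have hchain : IsChain Prec (range c) := by
    rintro _ ⟨a, rfl⟩ _ ⟨b, rfl⟩ hne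
    have hab : (o a).1 ≠ (o b).1 := fun h => hne (by simp only [c, h])
    exact (hFc (o a).2 (o b).2 hab).imp (fun h => h.restrict hne) fun h => h.restrict hne.symm
  refine hpos.not_ge ((hMB (range c) hbd hunc hchain).2 ?_)
  rintro _ ⟨_, ⟨a, rfl⟩, _, ⟨b, rfl⟩, hab, rfl⟩
  exact hc a b fun h => hab.1 (congrArg c h)

theorem hasBishop_of_isEmpty [IsEmpty K] : HasBishop 𝕜 K := fun F _ hF _ =>
  absurd (subsingleton_of_subsingleton : F.Subsingleton).countable hF

end Chains

/-! ### Locally connected and relatively discrete sets -/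

section Topology

variable {K : Type*} [TopologicalSpace K]

theorem hasConnectedLocalBase_univ [LocallyConnectedSpace K] (t : K) :
    HasConnectedLocalBase univ t := by
  rintro _ ⟨O, hO, rfl⟩ ht
  obtain ⟨V, hVO, hV, htV, hVc⟩ :=
    locallyConnectedSpace_iff_subsets_isOpen_isConnected.1 ‹_› t O (hO.mem_nhds ht.1)
  exact ⟨V, ⟨V, hV, (inter_univ V).symm⟩, hVc, htV, by simpa using hVO⟩

/-- If `O` isolates `t` in `D`, then `O \ {t}` is open and misses `D`, hence misses `closure D`. -/
theorem exists_isOpen_inter_closure_eq_singleton [T1Space K] {D : Set K} (hD : IsDiscrete D)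
    {t : K} (ht : t ∈ D) : ∃ O, IsOpen O ∧ O ∩ closure D = {t} := by
  obtain ⟨O, hO, hOD⟩ := isDiscrete_iff_forall_mem_exists_isOpen.1 hD t ht
  refine ⟨O, hO, subset_antisymm (fun y hy => ?_) ?_⟩
  · by_contra hne
    obtain ⟨z, hz, hzD⟩ := mem_closure_iff.1 hy.2 (O \ {t}) (hO.sdiff isClosed_singleton)
      ⟨hy.1, hne⟩
    exact hz.2 (hOD.subset ⟨hz.1, hzD⟩)
  · rintro _ rfl
    exact ⟨(hOD.superset rfl).1, subset_closure ht⟩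

theorem IsDiscrete.isOpenIn_closure [T1Space K] {D : Set K} (hD : IsDiscrete D) :
    IsOpenIn D (closure D) := by
  choose! O hO hOD using fun t (ht : t ∈ D) => exists_isOpen_inter_closure_eq_singleton hD ht
  refine ⟨⋃ t ∈ D, O t, isOpen_biUnion hO, subset_antisymm (fun t ht => ?_) ?_⟩
  · exact ⟨mem_iUnion₂.2 ⟨t, ht, ((hOD t ht).superset rfl).1⟩, subset_closure ht⟩
  · rintro y ⟨hy, hyD⟩
    obtain ⟨t, ht, hyt⟩ := mem_iUnion₂.1 hy
    rwa [(hOD t ht).subset ⟨hyt, hyD⟩]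

theorem IsDiscrete.hasConnectedLocalBase_closure [T1Space K] {D : Set K} (hD : IsDiscrete D)
    {t : K} (ht : t ∈ D) : HasConnectedLocalBase (closure D) t := by
  intro U _ htU
  obtain ⟨O, hO, hOD⟩ := exists_isOpen_inter_closure_eq_singleton hD ht
  exact ⟨{t}, ⟨O, hO, hOD.symm⟩, isConnected_singleton, rfl, singleton_subset_iff.2 htU⟩

end Topology

end Bish

theorem theorem3p3 {𝕜 K : Type*} [RCLike 𝕜] [TopologicalSpace K] [CompactSpace K] [T2Space K] :
    (∀ (M : TopologicalSpace.Closeds K) (H : ℕ → Set K),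
      (M : Set K)ᶜ = ⋃ n, H n →
      (∀ n, Bish.IsOpenIn (H n) (closure (H n))) →
      (∀ n, ∀ t ∈ H n, Bish.HasConnectedLocalBase (closure (H n)) t) →
      (∀ (δ : ℝ) (hδ : 0 < δ) (F : Set C(K, 𝕜)) (hF : Bish.IsDeltaChain δ F),
        ∀ E ∈ (Bish.simSetoid hF.isChain M hδ).classes,
          E.Countable ∧ Bish.IsScatteredOrder (fun f g : F => Bish.Prec f.1 g.1) E) ∧
      (Bish.HasBishop 𝕜 (M : Set K) → Bish.HasBishop 𝕜 K) ∧
      ((M : Set K) = ∅ → Bish.HasBishop 𝕜 K)) ∧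
    (LocallyConnectedSpace K → Bish.HasBishop 𝕜 K) ∧
    (Bish.IsSigmaDiscrete K → Bish.HasBishop 𝕜 K) := by
  have main : ∀ (M : TopologicalSpace.Closeds K) (H : ℕ → Set K),
      (M : Set K)ᶜ = ⋃ n, H n →
      (∀ n, Bish.IsOpenIn (H n) (closure (H n))) →
      (∀ n, ∀ t ∈ H n, Bish.HasConnectedLocalBase (closure (H n)) t) →
      (∀ (δ : ℝ) (hδ : 0 < δ) (F : Set C(K, 𝕜)) (hF : Bish.IsDeltaChain δ F),
        ∀ E ∈ (Bish.simSetoid hF.isChain M hδ).classes,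
          E.Countable ∧ Bish.IsScatteredOrder (fun f g : F => Bish.Prec f.1 g.1) E) ∧
      (Bish.HasBishop 𝕜 (M : Set K) → Bish.HasBishop 𝕜 K) ∧
      ((M : Set K) = ∅ → Bish.HasBishop 𝕜 K) := by
    intro M H hM hH hloc
    have h₁ := fun (δ : ℝ) (hδ : 0 < δ) (F : Set C(K, 𝕜)) (hF : Bish.IsDeltaChain δ F) =>
      fun E (hE : E ∈ (Bish.simSetoid hF.isChain M hδ).classes) =>
        Bish.countable_and_isScatteredOrder_of_mem_classes hM hH hloc hδ hF hE
    have h₂ : Bish.HasBishop 𝕜 (M : Set K) → Bish.HasBishop 𝕜 K :=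
      Bish.hasBishop_of_countable_classes fun δ hδ F hF E hE => (h₁ δ hδ F hF E hE).1
    refine ⟨h₁, h₂, fun h => h₂ ?_⟩
    have : IsEmpty (M : Set K) := Set.isEmpty_coe_sort.2 h
    exact Bish.hasBishop_of_isEmpty
  refine ⟨main, fun _ => ?_, ?_⟩
  -- The empty `M` with every `H n` equal to the whole space.
  · refine (main ⊥ (fun _ => Set.univ) (by simp [Set.iUnion_const]) (fun _ => ⟨Set.univ, isOpen_univ, by simp⟩)
      fun _ t _ => ?_).2.2 rfl
    rw [closure_univ]
    exact Bish.hasConnectedLocalBase_univ t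
  · rintro ⟨D, hD, hu⟩
    exact (main ⊥ D (by simp [hu]) (fun n => Bish.IsDiscrete.isOpenIn_closure (hD n))
      fun n t ht => Bish.IsDiscrete.hasConnectedLocalBase_closure (hD n) ht).2.2 rfl
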